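/- Theorem. Let $n\ge 0$ and $k\ge 1$ be integers. Put $s_i=(2^k+1)\,2^{n+i}-(2^k-1)$ for $i\in\mathbb N=\{0,1,2,\dots\}$, and let $GT(n,k)=\langle\{s_i : i\in\mathbb N\}\rangle$ be the submonoid of $(\mathbb N,+)$ generated by all the $s_i$. For $S=GT(n,k)$ let $Ap(S,s_0)=\{a\in S : a-s_0\notin S\}$ be the Apéry set and let $F(S)$ be the Frobenius number, i.e. the greatest integer not belonging to $S$. Call integers $t_1,\dots,t_m\in\{0,1,2\}$ *admissible* if $t_j=2$ implies $t_i=0$ for all $i<j$, and put $$P_m=\sum_{i=1}^m(2^i-1)\,t_i,\qquad Q_m=\sum_{i=1}^m t_i s_i .$$ Then $\max Ap(GT(n,k),s_0)$ and $F(GT(n,k))$ exist and are given as follows. 1. If $n=0$: $\max Ap=s_1$ and $F=s_1-2$ (here $s_0=2$). 2. If $n\ge 1$ and $k=1$: $\max Ap=s_n+s_{n+1}$ and $F=s_n+s_{n+1}-s_0$. 3. If $2\le k<n$: there are admissible $t_1,\dots,t_{n-2}$ with $P_{n-2}=2^{n-1}-2^k+2$, and for any such choice $\max Ap=Q_{n-2}+s_{n-1}+s_{n+k}$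 and $F=Q_{n-2}+s_{n-1}+s_{n+k}-s_0$. 4. If $n=k\ge 1$: $\max Ap=s_1+s_{2n}$ and $F=s_1+s_{2n}-s_0$. 5. If $n\ge 1$, $k>n$ and $k\ne 2$: there are admissible $t_1,\dots,t_{k-1}$ with $P_{k-1}=2^n+n$, and for any such choice $\max Ap=Q_{k-1}+s_k+s_{k+1}+\dots+s_{n+k-1}$ and $F=Q_{k-1}+s_k+s_{k+1}+\dots+s_{n+k-1}-s_0$. 6. If $n=1$ and $k=2$: $\max Ap=74$ and $F=67$. -/

import Mathlib

namespace GenThabit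

/-- The generator `s_i = (2^k + 1) * 2^(n+i) - (2^k - 1)`. The subtractions of natural numbers never
truncate, see `cast_s`. -/
def s (n k i : ℕ) : ℕ := (2 ^ k + 1) * 2 ^ (n + i) - (2 ^ k - 1)

theorem cast_s (n k i : ℕ) :
    (s n k i : ℤ) = (2 ^ k + 1) * 2 ^ (n + i) - (2 ^ k - 1) := by
  have h1 : 1 ≤ 2 ^ k := Nat.one_le_two_pow
  have h2 : 1 ≤ 2 ^ (n + i) := Nat.one_le_two_pow
  have h3 : 2 ^ k - 1 ≤ (2 ^ k + 1) * 2 ^ (n + i) := by nlinarith [Nat.sub_le (2 ^ k) 1]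
  unfold s
  push_cast [Nat.cast_sub h3, Nat.cast_sub h1]
  ring

/-- The generalized Thabit numerical semigroup `GT(n,k)`: the submonoid of `(ℕ, +)` generated by
all the `s_i`, `i ∈ ℕ`. -/
def GThabit (n k : ℕ) : AddSubmonoid ℕ := AddSubmonoid.closure (Set.range (s n k))

/-- The Apéry set `Ap(S,x) = {a ∈ S | a - x ∉ S}`, the difference being taken in `ℤ`. -/
def Ap (S : AddSubmonoid ℕ) (x : ℕ) : Set ℕ := {a | a ∈ S ∧ ∀ b ∈ S, (b : ℤ) ≠ (a : ℤ) - (x : ℤ)}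

/-- The condition on the coefficients `t_1, …, t_m`: they all lie in `{0, 1, 2}`, and whenever
`t_j = 2`, all the coefficients before `t_j` are zero. -/
def Admissible (m : ℕ) (t : ℕ → ℕ) : Prop :=
  (∀ i ∈ Finset.Icc 1 m, t i ≤ 2) ∧
    ∀ j ∈ Finset.Icc 1 m, t j = 2 → ∀ i ∈ Finset.Icc 1 m, i < j → t i = 0

/-- `P_m = t_1 + (2^2 - 1) t_2 + ⋯ + (2^m - 1) t_m`. -/
def P (m : ℕ) (t : ℕ → ℕ) : ℕ := ∑ i ∈ Finset.Icc 1 m, (2 ^ i - 1) * t i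

/-- `Q_m = t_1 s_1 + ⋯ + t_m s_m`. -/
def Q (n k m : ℕ) (t : ℕ → ℕ) : ℕ := ∑ i ∈ Finset.Icc 1 m, t i * s n k i

end GenThabit

namespace GenThabit

/-! Write `c = 2^k - 1`. Since `s_i = c (2^i - 1) + s_0 2^i`, every element of the semigroup is `c x
+ s_0 w` with `x ≤ v₂(w!)`: the exponent of `2` in `(2^i)!` is `2^i - 1`, and `v₂` of factorials is
superadditive. As `c` is a unit modulo `s_0`, the residue of an element determines `x` modulo `s_0`.
An admissible `t` has the least `w` with `v₂(w!) ≥ P t` as its weight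
(`Admissible.weight_le_of_P_le`), and every `P`-value is attained. So the Apéry element for the
residue of `c r`, `r < s_0`, is `Q t` with `P t = r`; it increases with `r`, and the maximum has `P
t = s_0 - 1`. Each case exhibits such a `t`. -/

/-! ### The 2-adic valuation of factorials -/

/-- The exponent of `2` in `m!`. -/
def factorialVal (m : ℕ) : ℕ := (Nat.factorial m).factorization 2

theorem factorialVal_add_le (a b : ℕ) :
    factorialVal a + factorialVal b ≤ factorialVal (a + b) := by
  have h := (Nat.factorization_le_iff_dvd
    (mul_ne_zero (Nat.factorial_ne_zero a) (Nat.factorial_ne_zero b))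
    (Nat.factorial_ne_zero (a + b))).2 (Nat.factorial_mul_factorial_dvd_factorial_add a b) 2
  rwa [Nat.factorization_mul (Nat.factorial_ne_zero a) (Nat.factorial_ne_zero b)] at h

theorem factorialVal_mono : Monotone factorialVal := by
  intro a b hab
  obtain ⟨d, rfl⟩ := Nat.exists_eq_add_of_le hab
  exact (Nat.le_add_right _ _).trans (factorialVal_add_le a d)

theorem factorialVal_succ (m : ℕ) :
    factorialVal (m + 1) = (m + 1).factorization 2 + factorialVal m := by
  unfold factorialVal
  rw [Nat.factorial_succ, Nat.factorization_mul (Nat.succ_ne_zero m) (Nat.factorial_ne_zero m)]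
  rfl

theorem factorization_two_pow_add {j u : ℕ} (hu : 0 < u) (huj : u < 2 ^ j) :
    (2 ^ j + u).factorization 2 = u.factorization 2 := by
  have hlt : u.factorization 2 < j := by
    have h1 : 2 ^ u.factorization 2 ≤ u := Nat.le_of_dvd hu (Nat.ordProj_dvd u 2)
    exact (Nat.pow_lt_pow_iff_right (by norm_num)).1 (h1.trans_lt huj)
  have key : ∀ e, e ≤ j → (2 ^ e ∣ 2 ^ j + u ↔ 2 ^ e ∣ u) := fun e he =>
    (Nat.dvd_add_right (pow_dvd_pow 2 he))
  have hdvd : ∀ {x : ℕ} (e : ℕ), x ≠ 0 → (2 ^ e ∣ x ↔ e ≤ x.factorization 2) := fun e hx =>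
    Nat.prime_two.pow_dvd_iff_le_factorization hx
  have h1 := (hdvd (u.factorization 2) (x := 2 ^ j + u) (by omega)).1
    ((key _ hlt.le).2 (Nat.ordProj_dvd u 2))
  have h2 : ¬ (u.factorization 2 + 1 ≤ (2 ^ j + u).factorization 2) := fun h => by
    have := (hdvd _ hu.ne').1 ((key _ hlt).1 ((hdvd _ (by omega)).2 h))
    omega
  omega

/-- For `0 < i < 2^j` the factors `2^j + i` and `i` have the same 2-adic valuation, so
superadditivity is an equality here. -/
theorem factorialVal_two_pow_add_of_lt (j u : ℕ) (hu : u < 2 ^ j) :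
    factorialVal (2 ^ j + u) = factorialVal (2 ^ j) + factorialVal u := by
  induction u with
  | zero => simp [factorialVal]
  | succ u ih =>
    rw [← add_assoc, factorialVal_succ, factorialVal_succ u, ih (by omega), add_assoc,
      factorization_two_pow_add (Nat.succ_pos u) hu]
    ring

theorem factorialVal_two_pow_sub_one (j : ℕ) :
    factorialVal (2 ^ j) = j + factorialVal (2 ^ j - 1) := by
  have h : 2 ^ j - 1 + 1 = 2 ^ j := Nat.sub_add_cancel Nat.one_le_two_pow
  have := factorialVal_succ (2 ^ j - 1)
  rw [h] at this
  rw [this, Nat.prime_two.factorization_pow]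
  simp

theorem factorialVal_two_pow (j : ℕ) : factorialVal (2 ^ j) = 2 ^ j - 1 := by
  induction j with
  | zero => simp [factorialVal]
  | succ j ih =>
    have h1 := factorialVal_two_pow_sub_one j
    have h2 := factorialVal_two_pow_sub_one (j + 1)
    have hp : 1 ≤ 2 ^ j := Nat.one_le_two_pow
    have h3 := factorialVal_two_pow_add_of_lt j (2 ^ j - 1) (by omega)
    have h4 : 2 ^ (j + 1) - 1 = 2 ^ j + (2 ^ j - 1) := by rw [pow_succ]; omega
    rw [h4] at h2 ⊢
    omega

/-! ### Admissible coefficients and minimal weight -/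

/-- The weight `2 t_1 + 4 t_2 + ⋯ + 2^m t_m`. -/
def weight (m : ℕ) (t : ℕ → ℕ) : ℕ := ∑ i ∈ Finset.Icc 1 m, 2 ^ i * t i

theorem weight_succ (m : ℕ) (t : ℕ → ℕ) :
    weight (m + 1) t = weight m t + 2 ^ (m + 1) * t (m + 1) :=
  Finset.sum_Icc_succ_top (by omega) _

theorem P_succ (m : ℕ) (t : ℕ → ℕ) :
    P (m + 1) t = P m t + (2 ^ (m + 1) - 1) * t (m + 1) :=
  Finset.sum_Icc_succ_top (by omega) _

theorem Admissible.of_succ {m : ℕ} {t : ℕ → ℕ} (h : Admissible (m + 1) t) : Admissible m t := by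
  have hsub : ∀ i ∈ Finset.Icc 1 m, i ∈ Finset.Icc 1 (m + 1) := by
    intro i hi
    rw [Finset.mem_Icc] at hi ⊢
    omega
  exact ⟨fun i hi => h.1 i (hsub i hi), fun j hj hj2 i hi => h.2 j (hsub j hj) hj2 i (hsub i hi)⟩

theorem P_weight_eq_zero {m : ℕ} {t : ℕ → ℕ} (h : ∀ i ∈ Finset.Icc 1 m, t i = 0) :
    P m t = 0 ∧ weight m t = 0 :=
  ⟨Finset.sum_eq_zero fun i hi => by rw [h i hi, mul_zero],
    Finset.sum_eq_zero fun i hi => by rw [h i hi, mul_zero]⟩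

theorem Admissible.zero_of_top_eq_two {m : ℕ} {t : ℕ → ℕ} (h : Admissible (m + 1) t)
    (h2 : t (m + 1) = 2) : P m t = 0 ∧ weight m t = 0 := by
  refine P_weight_eq_zero fun i hi => ?_
  rw [Finset.mem_Icc] at hi
  exact h.2 (m + 1) (by simp) h2 i (by rw [Finset.mem_Icc]; omega) (by omega)

theorem Admissible.weight_le {m : ℕ} {t : ℕ → ℕ} (h : Admissible m t) :
    weight m t ≤ 2 ^ (m + 1) := by
  induction m with
  | zero => simp [weight]
  | succ m ih =>
    have h1 := ih h.of_succ
    have h2 := h.1 (m + 1) (by simp)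
    have hp : 2 ^ (m + 2) = 2 * 2 ^ (m + 1) := by ring
    rw [weight_succ, hp]
    interval_cases hv : t (m + 1)
    · omega
    · omega
    · have := (h.zero_of_top_eq_two hv).2
      omega

/-- Induction on the top coefficient. If it is 1, the leading power of two splits off the factorial;
if it is 2, all lower terms vanish and the weight is itself a power of two. -/
theorem Admissible.factorialVal_weight_sub_one_lt {m : ℕ} {t : ℕ → ℕ} (h : Admissible m t)
    (hw : weight m t ≠ 0) : factorialVal (weight m t - 1) < P m t := by
  induction m with
  | zero => simp [weight] at hw
  | succ m ih =>
    have h1 := h.of_succ.weight_le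
    have h2 := h.1 (m + 1) (by simp)
    have hp : 2 ≤ 2 ^ (m + 1) := by
      rw [pow_succ]
      have : 1 ≤ 2 ^ m := Nat.one_le_two_pow
      omega
    rw [weight_succ] at hw ⊢
    rw [P_succ]
    interval_cases hv : t (m + 1)
    · simpa using ih h.of_succ (by simpa using hw)
    · rw [mul_one, mul_one]
      have hpow := factorialVal_two_pow (m + 1)
      by_cases hz : weight m t = 0
      · rw [hz, zero_add]
        have := factorialVal_two_pow_sub_one (m + 1)
        omega
      · have h3 := ih h.of_succ hz
        have h4 : weight m t + 2 ^ (m + 1) - 1 = 2 ^ (m + 1) + (weight m t - 1) := by omega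
        rw [h4, factorialVal_two_pow_add_of_lt _ _ (by omega)]
        omega
    · obtain ⟨h3, h4⟩ := h.zero_of_top_eq_two hv
      have h5 := factorialVal_two_pow (m + 2)
      have h6 := factorialVal_two_pow_sub_one (m + 2)
      have h7 : 2 ^ (m + 2) = 2 ^ (m + 1) * 2 := by ring
      rw [h3, h4, zero_add, zero_add, ← h7]
      omega

/-- Admissible coefficients have the least weight among all sums that are at least as large. -/
theorem Admissible.weight_le_of_P_le {m : ℕ} {t : ℕ → ℕ} (h : Admissible m t) {x w : ℕ}
    (hx : P m t ≤ x) (hxw : x ≤ factorialVal w) : weight m t ≤ w := by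
  by_contra! hlt
  have h1 := h.factorialVal_weight_sub_one_lt (by omega)
  have h2 := factorialVal_mono (show w ≤ weight m t - 1 by omega)
  omega

theorem P_le_factorialVal_weight (m : ℕ) (t : ℕ → ℕ) : P m t ≤ factorialVal (weight m t) := by
  have hmul : ∀ a b : ℕ, factorialVal a * b ≤ factorialVal (a * b) := by
    intro a b
    induction b with
    | zero => simp
    | succ b ih =>
      rw [mul_add_one, mul_add_one]
      exact (Nat.add_le_add_right ih _).trans (factorialVal_add_le _ _)
  induction m with
  | zero => simp [P]
  | succ m ih =>
    rw [P_succ, weight_succ, ← factorialVal_two_pow]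
    exact (add_le_add ih (hmul _ _)).trans (factorialVal_add_le _ _)

theorem exists_admissible_P_eq (m r : ℕ) (hr : r ≤ 2 ^ (m + 1) - 2) :
    ∃ t, Admissible m t ∧ P m t = r := by
  induction m generalizing r with
  | zero => exact ⟨0, by simp [Admissible], by simp [P] at hr ⊢; omega⟩
  | succ m ih =>
    have hp : 2 ^ (m + 2) = 2 * 2 ^ (m + 1) := by ring
    have hp1 : 2 ≤ 2 ^ (m + 1) := by
      rw [pow_succ]
      have : 1 ≤ 2 ^ m := Nat.one_le_two_pow
      omega
    have ext : ∀ (t : ℕ → ℕ) (a : ℕ), Admissible m t → a ≤ 1 →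
        Admissible (m + 1) (Function.update t (m + 1) a) ∧
          P (m + 1) (Function.update t (m + 1) a) = P m t + (2 ^ (m + 1) - 1) * a := by
      intro t a ht ha
      have hlow : ∀ i ∈ Finset.Icc 1 (m + 1), i ≠ m + 1 → i ∈ Finset.Icc 1 m := by
        intro i hi hne
        rw [Finset.mem_Icc] at hi ⊢
        omega
      refine ⟨⟨fun i hi => ?_, fun j hj hj2 i hi hij => ?_⟩, ?_⟩
      · by_cases him : i = m + 1
        · subst him
          rw [Function.update_self]
          omega
        · rw [Function.update_of_ne him]
          exact ht.1 i (hlow i hi him)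
      · by_cases hjm : j = m + 1
        · subst hjm
          rw [Function.update_self] at hj2
          omega
        · rw [Function.update_of_ne hjm] at hj2
          have hjm' := hlow j hj hjm
          have him : i ≠ m + 1 := by
            rw [Finset.mem_Icc] at hjm'
            omega
          rw [Function.update_of_ne him]
          exact ht.2 j hjm' hj2 i (hlow i hi him) hij
      · rw [P_succ, Function.update_self]
        congr 1
        refine Finset.sum_congr rfl fun i hi => ?_
        rw [Finset.mem_Icc] at hi
        rw [Function.update_of_ne (by omega)]
    -- Greedy choice: the top coefficient is 2 only at the maximal value `2 (2^(m+1) - 1)`, where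
    -- all the others are 0.
    rcases lt_trichotomy r (2 ^ (m + 2) - 2) with hlt | heq | hgt
    · by_cases hsmall : r ≤ 2 ^ (m + 1) - 2
      · obtain ⟨t, ht, hPt⟩ := ih r hsmall
        obtain ⟨h1, h2⟩ := ext t 0 ht (by norm_num)
        exact ⟨_, h1, by rw [h2, hPt]; simp⟩
      · obtain ⟨t, ht, hPt⟩ := ih (r - (2 ^ (m + 1) - 1)) (by omega)
        obtain ⟨h1, h2⟩ := ext t 1 ht le_rfl
        exact ⟨_, h1, by rw [h2, hPt]; omega⟩
    · refine ⟨fun i => if i = m + 1 then 2 else 0, ⟨fun i _ => ?_, fun j _ hj2 i _ hij => ?_⟩, ?_⟩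
      · dsimp only
        split_ifs <;> omega
      · dsimp only at hj2 ⊢
        split_ifs at hj2 ⊢ <;> omega
      · rw [P_succ, (P_weight_eq_zero fun i hi => ?_).1]
        · simp only [if_true]
          omega
        · rw [Finset.mem_Icc] at hi
          exact if_neg (by omega)
    · omega

/-! ### Semigroup elements in the form `(2^k - 1) x + s_0 w` -/

theorem s_eq (n k i : ℕ) : s n k i = (2 ^ k - 1) * (2 ^ i - 1) + s n k 0 * 2 ^ i := by
  zify [Nat.one_le_two_pow (n := k), Nat.one_le_two_pow (n := i)]
  rw [cast_s, cast_s]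
  ring

theorem Q_eq {n k : ℕ} (m : ℕ) (t : ℕ → ℕ) :
    Q n k m t = (2 ^ k - 1) * P m t + s n k 0 * weight m t := by
  rw [Q, P, weight, Finset.mul_sum, Finset.mul_sum, ← Finset.sum_add_distrib]
  refine Finset.sum_congr rfl fun i _ => ?_
  rw [s_eq]
  ring

theorem coprime_two_pow_sub_one_s_zero {k : ℕ} (n : ℕ) (hk : 1 ≤ k) :
    Nat.Coprime (2 ^ k - 1) (s n k 0) := by
  have hp : 1 ≤ 2 ^ k := Nat.one_le_two_pow
  have hodd : Nat.Coprime (2 ^ k - 1) 2 :=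
    Nat.coprime_two_right.2 (Nat.Even.sub_odd hp (even_two.pow_of_ne_zero (by omega)) odd_one)
  have h : s n k 0 + (2 ^ k - 1) = (2 ^ k - 1) * 2 ^ n + 2 ^ (n + 1) := by
    zify [hp]
    rw [cast_s]
    ring
  rw [← Nat.coprime_add_self_right, h, Nat.coprime_mul_left_add_right]
  exact hodd.pow_right _

theorem two_le_s_zero {k : ℕ} (n : ℕ) (hk : 1 ≤ k) : 2 ≤ s n k 0 := by
  zify
  rw [cast_s]
  have h1 : (2 : ℤ) ≤ 2 ^ k := by
    simpa using pow_le_pow_right₀ (by norm_num : (1 : ℤ) ≤ 2) hk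
  have h2 : (1 : ℤ) ≤ 2 ^ (n + 0) := one_le_pow₀ (by norm_num)
  nlinarith

theorem exists_of_mem_GThabit {n k y : ℕ} (hy : y ∈ GThabit n k) :
    ∃ x w, x ≤ factorialVal w ∧ y = (2 ^ k - 1) * x + s n k 0 * w := by
  induction hy using AddSubmonoid.closure_induction with
  | mem y hy =>
    obtain ⟨i, rfl⟩ := hy
    exact ⟨2 ^ i - 1, 2 ^ i, (factorialVal_two_pow i).ge, s_eq n k i⟩
  | zero => exact ⟨0, 0, Nat.zero_le _, by simp⟩
  | add a b _ _ ha hb =>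
    obtain ⟨x, w, hx, rfl⟩ := ha
    obtain ⟨x', w', hx', rfl⟩ := hb
    exact ⟨x + x', w + w', (add_le_add hx hx').trans (factorialVal_add_le _ _), by ring⟩

theorem s_mem_GThabit (n k i : ℕ) : s n k i ∈ GThabit n k :=
  AddSubmonoid.subset_closure ⟨i, rfl⟩

theorem Q_mem_GThabit (n k m : ℕ) (t : ℕ → ℕ) : Q n k m t ∈ GThabit n k := by
  refine AddSubmonoid.sum_mem _ fun i _ => ?_
  rw [← smul_eq_mul]
  exact AddSubmonoid.nsmul_mem _ (s_mem_GThabit n k i) _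

/-! ### The largest Apéry element and the Frobenius number -/

section Greatest

variable {n k m : ℕ} {t : ℕ → ℕ}

theorem weight_ne_zero_of_P_eq (hk : 1 ≤ k) (hP : P m t = s n k 0 - 1) : weight m t ≠ 0 := by
  intro h
  have h1 := P_le_factorialVal_weight m t
  have h2 := two_le_s_zero n hk
  have h3 : factorialVal 0 = 0 := by simp [factorialVal]
  rw [h, h3] at h1
  omega

theorem s_zero_le_Q (hk : 1 ≤ k) (hP : P m t = s n k 0 - 1) : s n k 0 ≤ Q n k m t := by
  rw [Q_eq]
  exact (Nat.le_mul_of_pos_right _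
    (Nat.pos_of_ne_zero (weight_ne_zero_of_P_eq hk hP))).trans (Nat.le_add_left _ _)

theorem Q_sub_notMem (hk : 1 ≤ k) (ht : Admissible m t) (hP : P m t = s n k 0 - 1) :
    Q n k m t - s n k 0 ∉ GThabit n k := by
  intro hmem
  obtain ⟨x, w, hxw, h⟩ := exists_of_mem_GThabit hmem
  have hle := s_zero_le_Q hk hP
  have hs := two_le_s_zero n hk
  have heq : (2 ^ k - 1) * x + s n k 0 * (w + 1) =
      (2 ^ k - 1) * P m t + s n k 0 * weight m t := by
    rw [← Q_eq, mul_add_one]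
    omega
  have hmod : (2 ^ k - 1) * x ≡ (2 ^ k - 1) * P m t [MOD s n k 0] := by
    have := congrArg (· % s n k 0) heq
    simpa [Nat.ModEq] using this
  have hmod' : x ≡ P m t [MOD s n k 0] :=
    Nat.ModEq.cancel_left_of_coprime (coprime_two_pow_sub_one_s_zero n hk).symm hmod
  have hx : P m t ≤ x := by
    -- `P m t = s_0 - 1` is the least natural number in its class, so `x` cannot be smaller.
    have h1 : P m t % s n k 0 = P m t := Nat.mod_eq_of_lt (by omega)
    rw [← h1, ← hmod']
    exact Nat.mod_le _ _
  have hw := ht.weight_le_of_P_le hx hxw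
  have h1 := Nat.mul_le_mul_left (2 ^ k - 1) hx
  have h2 := Nat.mul_le_mul_left (s n k 0) hw
  rw [mul_add_one] at heq
  omega

/-- The minimal element in the class of `y` has both its `P`-value `r` and its weight bounded by
those of `t`; the bound on `y` leaves a nonnegative multiple of `s_0` to add to it. -/
theorem mem_GThabit_of_lt (hk : 1 ≤ k) (hP : P m t = s n k 0 - 1) {y : ℕ}
    (hy : Q n k m t < y + s n k 0) : y ∈ GThabit n k := by
  have hs := two_le_s_zero n hk
  have hcop := coprime_two_pow_sub_one_s_zero n hk
  obtain ⟨r, hr, hmod⟩ : ∃ r, r < s n k 0 ∧ (2 ^ k - 1) * r ≡ y [MOD s n k 0] := by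
    obtain ⟨z, hz⟩ := Nat.exists_mul_mod_eq_one_of_coprime hcop (by omega)
    refine ⟨(z * y) % s n k 0, Nat.mod_lt _ (by omega), ?_⟩
    have h1 : (2 ^ k - 1) * z ≡ 1 [MOD s n k 0] := by
      rw [Nat.ModEq, hz.2, Nat.mod_eq_of_lt (by omega)]
    calc (2 ^ k - 1) * ((z * y) % s n k 0) ≡ (2 ^ k - 1) * (z * y) [MOD s n k 0] :=
          (Nat.mod_modEq _ _).mul_left _
      _ = (2 ^ k - 1) * z * y := by ring
      _ ≡ 1 * y [MOD s n k 0] := h1.mul_right _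
      _ = y := one_mul y
  obtain ⟨t', ht', hP'⟩ := exists_admissible_P_eq r r (by
    have := Nat.lt_two_pow_self (n := r)
    rw [pow_succ]
    omega)
  have hww : weight r t' ≤ weight m t :=
    ht'.weight_le_of_P_le (by omega) (P_le_factorialVal_weight m t)
  have hcr : (2 ^ k - 1) * r ≤ (2 ^ k - 1) * P m t := Nat.mul_le_mul_left _ (by omega)
  have hpos : s n k 0 ≤ s n k 0 * weight m t :=
    Nat.le_mul_of_pos_right _ (Nat.pos_of_ne_zero (weight_ne_zero_of_P_eq hk hP))
  rw [Q_eq] at hy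
  have hle : (2 ^ k - 1) * r ≤ y := by omega
  obtain ⟨w, hw⟩ := (Nat.modEq_iff_dvd' hle).1 hmod
  have hwt : weight m t < w + 1 := by
    refine Nat.lt_of_mul_lt_mul_left (a := s n k 0) ?_
    rw [mul_add_one]
    omega
  have hyeq : y = Q n k r t' + (w - weight r t') * s n k 0 := by
    obtain ⟨d, rfl⟩ := Nat.exists_eq_add_of_le (show weight r t' ≤ w by omega)
    rw [Q_eq, hP', Nat.add_sub_cancel_left]
    rw [mul_add] at hw
    rw [mul_comm d]
    omega
  rw [hyeq, ← smul_eq_mul]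
  exact add_mem (Q_mem_GThabit n k r t') (AddSubmonoid.nsmul_mem _ (s_mem_GThabit n k 0) _)

theorem isGreatest_Ap_Q (hk : 1 ≤ k) (ht : Admissible m t) (hP : P m t = s n k 0 - 1) :
    IsGreatest (Ap (GThabit n k) (s n k 0)) (Q n k m t) := by
  have hle := s_zero_le_Q hk hP
  refine ⟨⟨Q_mem_GThabit n k m t, fun b hb h => Q_sub_notMem hk ht hP ?_⟩, fun a ha => ?_⟩
  · rwa [show Q n k m t - s n k 0 = b by omega]
  · by_contra! hlt
    exact ha.2 (a - s n k 0) (mem_GThabit_of_lt hk hP (by omega)) (by omega)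

theorem frobeniusNumber_Q_sub (hk : 1 ≤ k) (ht : Admissible m t) (hP : P m t = s n k 0 - 1) :
    FrobeniusNumber (Q n k m t - s n k 0) (GThabit n k : Set ℕ) := by
  rw [FrobeniusNumber, AddSubmonoid.closure_eq]
  refine ⟨Q_sub_notMem hk ht hP, fun y hy => ?_⟩
  by_contra! hlt
  exact hy (mem_GThabit_of_lt hk hP (by omega))

end Greatest

/-! ### Appending coefficients 1 to an admissible sequence -/

/-- The sequence that agrees with `t` up to `m` and is the indicator of `A` afterwards. -/
def extend (m : ℕ) (t : ℕ → ℕ) (A : Finset ℕ) (i : ℕ) : ℕ :=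
  if i ≤ m then t i else if i ∈ A then 1 else 0

theorem sum_mul_extend {m L : ℕ} (t : ℕ → ℕ) {A : Finset ℕ} (hA : ∀ i ∈ A, m < i ∧ i ≤ L)
    (hmL : m ≤ L) (f : ℕ → ℕ) :
    ∑ i ∈ Finset.Icc 1 L, f i * extend m t A i =
      ∑ i ∈ Finset.Icc 1 m, f i * t i + ∑ i ∈ A, f i := by
  have h : ∀ i ∈ Finset.Icc 1 L, f i * extend m t A i =
      (if i ∈ Finset.Icc 1 m then f i * t i else 0) + (if i ∈ A then f i else 0) := by
    intro i hi
    rw [Finset.mem_Icc] at hi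
    unfold extend
    by_cases him : i ≤ m
    · have hiA : i ∉ A := fun h => by have := hA i h; omega
      simp [him, hiA, hi.1]
    · simp [him]
  rw [Finset.sum_congr rfl h, Finset.sum_add_distrib, ← Finset.sum_filter, ← Finset.sum_filter,
    Finset.filter_mem_eq_inter, Finset.filter_mem_eq_inter,
    Finset.inter_eq_right.2 (Finset.Icc_subset_Icc_right hmL), Finset.inter_eq_right.2]
  intro i hi
  have := hA i hi
  rw [Finset.mem_Icc]
  omega

theorem Admissible.extend {m : ℕ} {t : ℕ → ℕ} (ht : Admissible m t) (A : Finset ℕ) (L : ℕ) :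
    Admissible L (extend m t A) := by
  refine ⟨fun i hi => ?_, fun j hj hj2 i hi hij => ?_⟩
  · rw [Finset.mem_Icc] at hi
    unfold GenThabit.extend
    split_ifs with h
    · exact ht.1 i (Finset.mem_Icc.2 ⟨hi.1, h⟩)
    · omega
    · omega
  · rw [Finset.mem_Icc] at hi hj
    unfold GenThabit.extend at hj2 ⊢
    split_ifs at hj2 with h
    · rw [if_pos (by omega)]
      exact ht.2 j (Finset.mem_Icc.2 ⟨hj.1, h⟩) hj2 i (Finset.mem_Icc.2 ⟨hi.1, by omega⟩) hij
    · omega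

theorem isGreatest_Ap_and_frobeniusNumber {n k m : ℕ} (hk : 1 ≤ k) {t : ℕ → ℕ}
    (ht : Admissible m t) (A : Finset ℕ) (hA : ∀ i ∈ A, m < i)
    (hP : P m t + ∑ i ∈ A, (2 ^ i - 1) = s n k 0 - 1) :
    IsGreatest (Ap (GThabit n k) (s n k 0)) (Q n k m t + ∑ i ∈ A, s n k i) ∧
      FrobeniusNumber (Q n k m t + (∑ i ∈ A, s n k i) - s n k 0) (GThabit n k : Set ℕ) := by
  have hAL : ∀ i ∈ A, m < i ∧ i ≤ m + A.sup id := fun i hi =>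
    ⟨hA i hi, (Finset.le_sup (f := id) hi).trans (Nat.le_add_left _ _)⟩
  have hP' : P (m + A.sup id) (extend m t A) = s n k 0 - 1 := by
    rw [← hP]
    exact sum_mul_extend t hAL (Nat.le_add_right _ _) _
  have hQ : Q n k (m + A.sup id) (extend m t A) = Q n k m t + ∑ i ∈ A, s n k i := by
    have := sum_mul_extend t hAL (Nat.le_add_right _ _) (s n k)
    simpa only [Q, mul_comm] using this
  rw [← hQ]
  exact ⟨isGreatest_Ap_Q hk (ht.extend A _) hP', frobeniusNumber_Q_sub hk (ht.extend A _) hP'⟩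

/-! ### Decompositions of `s_0 - 1` in the six cases -/

theorem s_zero_sub_one (n k : ℕ) : s n k 0 - 1 = 2 ^ (n + k) + 2 ^ n - 2 ^ k := by
  have h : s n k 0 + 2 ^ k = 2 ^ (n + k) + 2 ^ n + 1 := by
    zify
    rw [cast_s]
    ring
  omega

theorem sum_Icc_two_pow_sub_one (k n : ℕ) :
    ∑ i ∈ Finset.Icc (k + 1) (k + n), (2 ^ i - 1) + n + 2 ^ (k + 1) = 2 ^ (n + (k + 1)) := by
  induction n with
  | zero => simp
  | succ n ih =>
    have hp : 1 ≤ 2 ^ (k + (n + 1)) := Nat.one_le_two_pow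
    have h1 : 2 ^ (n + (k + 1)) = 2 ^ (k + (n + 1)) := by ring_nf
    have h2 : 2 ^ (n + 1 + (k + 1)) = 2 * 2 ^ (k + (n + 1)) := by ring
    rw [← add_assoc k n 1, Finset.sum_Icc_succ_top (by omega), add_assoc k n 1]
    omega

theorem admissible_zero (t : ℕ → ℕ) : Admissible 0 t := by simp [Admissible]

theorem isGreatest_Ap_and_frobeniusNumber_sum {n k : ℕ} (hk : 1 ≤ k) (A : Finset ℕ)
    (hA : ∀ i ∈ A, 0 < i) (hP : ∑ i ∈ A, (2 ^ i - 1) = s n k 0 - 1) :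
    IsGreatest (Ap (GThabit n k) (s n k 0)) (∑ i ∈ A, s n k i) ∧
      FrobeniusNumber ((∑ i ∈ A, s n k i) - s n k 0) (GThabit n k : Set ℕ) := by
  simpa [Q] using isGreatest_Ap_and_frobeniusNumber hk (admissible_zero 0) A hA
    (by simpa [P] using hP)

end GenThabit

open GenThabit in
theorem mainTheorem3 (n k : ℕ) (hk : 1 ≤ k) :
    (n = 0 →
      IsGreatest (Ap (GThabit n k) (s n k 0)) (s n k 1) ∧
      FrobeniusNumber (s n k 1 - 2) (GThabit n k : Set ℕ)) ∧
    (n ≠ 0 → k = 1 →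
      IsGreatest (Ap (GThabit n k) (s n k 0)) (s n k n + s n k (n + 1)) ∧
      FrobeniusNumber (s n k n + s n k (n + 1) - s n k 0) (GThabit n k : Set ℕ)) ∧
    (2 ≤ k → k < n →
      (∃ t : ℕ → ℕ, Admissible (n - 2) t ∧ P (n - 2) t = 2 ^ (n - 1) - 2 ^ k + 2) ∧
      ∀ t : ℕ → ℕ, Admissible (n - 2) t → P (n - 2) t = 2 ^ (n - 1) - 2 ^ k + 2 →
        IsGreatest (Ap (GThabit n k) (s n k 0))
          (Q n k (n - 2) t + s n k (n - 1) + s n k (n + k)) ∧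
        FrobeniusNumber
          (Q n k (n - 2) t + s n k (n - 1) + s n k (n + k) - s n k 0) (GThabit n k : Set ℕ)) ∧
    (n = k →
      IsGreatest (Ap (GThabit n k) (s n k 0)) (s n k 1 + s n k (2 * n)) ∧
      FrobeniusNumber (s n k 1 + s n k (2 * n) - s n k 0) (GThabit n k : Set ℕ)) ∧
    (n ≠ 0 → k ≠ 2 → n < k →
      (∃ t : ℕ → ℕ, Admissible (k - 1) t ∧ P (k - 1) t = 2 ^ n + n) ∧
      ∀ t : ℕ → ℕ, Admissible (k - 1) t → P (k - 1) t = 2 ^ n + n →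
        IsGreatest (Ap (GThabit n k) (s n k 0))
          (Q n k (k - 1) t + ∑ i ∈ Finset.Icc k (n + k - 1), s n k i) ∧
        FrobeniusNumber
          (Q n k (k - 1) t + (∑ i ∈ Finset.Icc k (n + k - 1), s n k i) - s n k 0)
          (GThabit n k : Set ℕ)) ∧
    (n = 1 → k = 2 →
      IsGreatest (Ap (GThabit n k) (s n k 0)) 74 ∧
      FrobeniusNumber 67 (GThabit n k : Set ℕ)) := by
  have hk2 : 2 ≤ 2 ^ k := by simpa using Nat.pow_le_pow_right (n := 2) (by norm_num) hk
  refine ⟨?_, ?_, ?_, ?_, ?_, ?_⟩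
  · rintro rfl
    have h0 : s 0 k 0 - 1 = 1 := by rw [s_zero_sub_one]; simp
    have h2 : s 0 k 0 = 2 := by omega
    have := isGreatest_Ap_and_frobeniusNumber_sum (n := 0) hk {1} (by simp) (by rw [h0]; simp)
    simpa [h2] using this
  · rintro hn rfl
    have hp : 1 ≤ 2 ^ n := Nat.one_le_two_pow
    have := isGreatest_Ap_and_frobeniusNumber_sum (n := n) hk {n, n + 1}
      (by simp; omega) (by
        rw [s_zero_sub_one, Finset.sum_pair (by omega), pow_succ]
        omega)
    rwa [Finset.sum_pair (by omega)] at this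
  · intro hk2' hkn
    have hk4 : 4 ≤ 2 ^ k := by simpa using Nat.pow_le_pow_right (n := 2) (by norm_num) hk2'
    have hkn' : 2 ^ k ≤ 2 ^ (n - 1) := Nat.pow_le_pow_right (by norm_num) (by omega)
    have hn : 2 ^ n = 2 * 2 ^ (n - 1) := by rw [← pow_succ']; congr 1; omega
    refine ⟨exists_admissible_P_eq _ _ ?_, fun t ht hP => ?_⟩
    · rw [show n - 2 + 1 = n - 1 by omega]
      omega
    · have hp : 1 ≤ 2 ^ (n + k) := Nat.one_le_two_pow
      have := isGreatest_Ap_and_frobeniusNumber (n := n) hk ht {n - 1, n + k}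
        (by simp; omega) (by
          rw [s_zero_sub_one, Finset.sum_pair (by omega), hP]
          omega)
      rwa [Finset.sum_pair (by omega), ← add_assoc] at this
  · rintro rfl
    have hp : 1 ≤ 2 ^ (2 * n) := Nat.one_le_two_pow
    have := isGreatest_Ap_and_frobeniusNumber_sum (n := n) hk {1, 2 * n}
      (by simp; omega) (by
        rw [s_zero_sub_one, Finset.sum_pair (by omega), ← two_mul]
        omega)
    rwa [Finset.sum_pair (by omega)] at this
  · intro hn hk2' hnk
    obtain ⟨j, rfl⟩ : ∃ j, k = j + 1 := ⟨k - 1, by omega⟩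
    rw [Nat.add_sub_cancel, show n + (j + 1) - 1 = j + n by omega]
    refine ⟨exists_admissible_P_eq _ _ ?_, fun t ht hP => ?_⟩
    · have h1 : 2 ^ n ≤ 2 ^ j := Nat.pow_le_pow_right (by norm_num) (by omega)
      -- This is where `k ≠ 2` matters: the inequality needs `j ≥ 2`, and for `n = j = 1` the target
      -- `2^n + n = 3` exceeds the largest value 2 of `P 1`.
      have h2 : j + 2 ≤ 2 ^ j := by
        obtain ⟨i, rfl⟩ : ∃ i, j = i + 2 := ⟨j - 2, by omega⟩
        have := Nat.lt_two_pow_self (n := i)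
        rw [pow_add]
        omega
      rw [pow_succ]
      omega
    · refine isGreatest_Ap_and_frobeniusNumber hk ht (Finset.Icc (j + 1) (j + n))
        (fun i hi => (Finset.mem_Icc.1 hi).1) ?_
      have := sum_Icc_two_pow_sub_one j n
      rw [s_zero_sub_one, hP]
      omega
  · rintro rfl rfl
    -- Here `s_0 - 1 = 6 = 2 (2^2 - 1)`, which gives `Q = 2 s_2 = 74`.
    have ht : Admissible 2 (fun i => if i = 2 then 2 else 0) := by
      refine ⟨fun i _ => ?_, fun j _ hj2 i _ hij => ?_⟩
      · dsimp only
        split_ifs <;> omega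
      · dsimp only at hj2 ⊢
        split_ifs at hj2 ⊢ <;> omega
    have hQ : Q 1 2 2 (fun i => if i = 2 then 2 else 0) = 74 := by decide
    have hs : s 1 2 0 = 7 := by decide
    have := isGreatest_Ap_and_frobeniusNumber (n := 1) hk ht ∅ (by simp) (by decide)
    simpa [hQ, hs] using this
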